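/- All groups act on the left; $\mathbb{Z}/2$ always carries the trivial action; $H^*(\Gamma,-)$ of a profinite group $\Gamma$ is continuous cohomology, and $H^1(\Gamma,\mathbb{Z}/2)$ is identified with the group of continuous homomorphisms $\Gamma\to\mathbb{Z}/2$. **The $\mathbb{Z}/2$-obstruction.** Let $f:G\to H$ be a surjective homomorphism of finite groups with kernel $P$, and suppose that $P$ is $\mathbb{Z}/2$-perfect, i.e. $P_{ab}\otimes\mathbb{Z}/2=0$ (equivalently, $|P_{ab}|$ is odd). Conjugation makes $H_2(P,\mathbb{Z}/2)$ a $G$-module on which $P$ acts trivially, hence an $H$-module. Let $$1\to H_2(P,\mathbb{Z}/2)\to C\xrightarrow{\pi} P\to 1$$ be the central extension whose class corresponds, under the universal coefficient isomorphism $H^2(P,H_2(P,\mathbb{Z}/2))\cong\operatorname{Hom}(H_2(P,\mathbb{Z}),H_2(P,\mathbb{Z}/2))$, to the reduction map $H_2(P,\mathbb{Z})\to H_2(P,\mathbb{Z}/2)$. There is a unique action of $G$ on $C$ which is compatible with its actions on $P$ and on $H_2(P,\mathbb{Z}/2)$ and for which $d:C\xrightarrow{\pi}P\subseteq G$ is a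 crossed module, i.e. $d({}^gc)=g\,d(c)\,g^{-1}$ and ${}^{d(c)}c'=cc'c^{-1}$. The resulting exact sequence $1\to H_2(P,\mathbb{Z}/2)\to C\to G\to H\to 1$ is classified by an element $\tilde o_2(f)\in H^3(H,H_2(P,\mathbb{Z}/2))$, namely the class of the cocycle $c$ with $${}^{s(g)}F(h,k)\,F(g,hk)=c(g,h,k)\,F(g,h)\,F(gh,k),$$ where $s:H\to G$ is a set-theoretic section of $f$ and $F:H\times H\to C$ satisfies $s(g)s(h)=d(F(g,h))\,s(gh)$. **Properties.** A finite group $G$ has property $(*)_a$ if there is a surjective homomorphism $f:G\to\mathbb{Z}/2$ with kernel $P$ such that $|P_{ab}|$ is odd and $\tilde o_2(f)\ne 0$. A finite group $G$ has property $(*)_b$ if there is a surjective homomorphism $f:G\to\mathbb{Z}/2\times\mathbb{Z}/2$ with kernel $P$ such that $|P_{ab}|$ is odd, $H_2(P,\mathbb{Z}/2)\cong\mathbb{Z}/2$, and under this identification $\tilde o_2(f)=a^2\cup b\in H^3(\mathbb{Z}/2\times\mathbb{Z}/2,\mathbb{Z}/2)$ for some distinct non-zero $a,b\in H^1(\mathbb{Z}/2\times\mathbb{Z}/2,\mathbb{Z}/2)$.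 A profinite group $\Gamma$ has property $(**)_a$ if $x\cup x\cup x\neq 0$ in $H^3(\Gamma,\mathbb{Z}/2)$ for every continuous surjection $x:\Gamma\to\mathbb{Z}/2$. It has property $(**)_b$ if $x\cup x\cup y\ne 0$ in $H^3(\Gamma,\mathbb{Z}/2)$ for any two distinct continuous surjections $x,y:\Gamma\to\mathbb{Z}/2$. **Theorem.** Let $G$ be a finite group and $\Gamma$ a profinite group. 1. Let $f:G\to\mathbb{Z}/2$ be a surjective homomorphism whose kernel is $\mathbb{Z}/2$-perfect, and let $p:\Gamma\to\mathbb{Z}/2$ be a continuous surjective homomorphism, with class $x\in H^1(\Gamma,\mathbb{Z}/2)$. If $x\cup x\cup x\ne0$ in $H^3(\Gamma,\mathbb{Z}/2)$ and $\tilde o_2(f)\neq 0$, then there is no continuous homomorphism $q:\Gamma\to G$ with $f\circ q=p$. 2. Let $f:G\to\mathbb{Z}/2\times\mathbb{Z}/2$ be a surjective homomorphism whose kernel $P$ is $\mathbb{Z}/2$-perfect and satisfies $H_2(P,\mathbb{Z}/2)\cong\mathbb{Z}/2$, and let $p:\Gamma\to\mathbb{Z}/2\times\mathbb{Z}/2$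 be a continuous surjective homomorphism. Suppose that $\tilde o_2(f)=a^2\cup b$ with $a,b\in H^1(\mathbb{Z}/2\times\mathbb{Z}/2,\mathbb{Z}/2)$ distinct and non-zero, and let $x_1,x_2\in H^1(\Gamma,\mathbb{Z}/2)$ be the pullbacks of $a$ and $b$ along $p$. If $x_1^2\cup x_2\neq 0$ in $H^3(\Gamma,\mathbb{Z}/2)$, then there is no continuous homomorphism $q:\Gamma\to G$ with $f\circ q=p$. 3. If $G$ has property $(*)_a$ and $\Gamma$ has property $(**)_a$, then there is no continuous surjective homomorphism $\Gamma\to G$. 4. If $G$ has property $(*)_b$ and $\Gamma$ has property $(**)_b$, then there is no continuous surjective homomorphism $\Gamma\to G$. -/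

import Mathlib

universe u

open CategoryTheory

noncomputable section

namespace EmbeddingObstruction

section Continuous

instance instContinuousSMulULift (R : Type) [CommRing R] [TopologicalSpace R]
    [IsTopologicalRing R] : ContinuousSMul R (ULift.{u} R) where
  continuous_smul := by
    refine continuous_uliftUp.comp (?_ : Continuous fun p : R × ULift.{u} R => p.1 * p.2.down)
    exact continuous_fst.mul (continuous_uliftDown.comp continuous_snd)

variable (R : Type) [CommRing R] [TopologicalSpace R] [IsTopologicalRing R]
  (Γ : Type u) [Group Γ] [TopologicalSpace Γ] [IsTopologicalGroup Γ]

/-- The trivial topological representation of `Γ` on the ring `R` (lifted to the universe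
of `Γ`). -/
def triv : TopRep.{u} R Γ := TopRep.of (ContRepresentation.trivial R Γ (ULift.{u} R))

/-- The module `C(Γ, C(Γ, …, R))` of continuous functions of `n` variables in `Γ`, with the
diagonal action of `Γ`. -/
abbrev Res (n : ℕ) : TopRep.{u} R Γ := TopRep.resolutionX (triv R Γ) n

variable {R Γ}

/-- Evaluation of a continuous function of `n + 1` variables at its first variable. -/
abbrev ev {n : ℕ} (f : Res R Γ (n + 1)) (g : Γ) : Res R Γ n :=
  DFunLike.coe (F := C(Γ, Res R Γ n)) f g

theorem ev_ext {n : ℕ} {f f' : Res R Γ (n + 1)} (h : ∀ g, ev f g = ev f' g) : f = f' :=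
  ContinuousMap.ext (X := Γ) (Y := Res R Γ n) h

theorem ev_ρ {n : ℕ} (f : Res R Γ (n + 1)) (γ g : Γ) :
    ev ((Res R Γ (n + 1)).ρ γ f) g = (Res R Γ n).ρ γ (ev f (γ⁻¹ * g)) := rfl

theorem ev_d {n : ℕ} (f : Res R Γ (n + 1)) (g : Γ) :
    ev (((triv R Γ).d (n + 1)).hom f) g = f - ((triv R Γ).d n).hom (ev f g) := rfl

variable (R Γ) in
/-- A homogeneous continuous `n`-cocycle of `Γ` with values in the trivial module `R`. -/
structure Cocycle (n : ℕ) where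
  /-- The underlying continuous function of `n + 1` variables. -/
  fn : Res R Γ (n + 1)
  invariant : fn ∈ (Res R Γ (n + 1)).ρ.invariants
  closed : ((triv R Γ).d (n + 1)).hom fn = 0

/-- A cocycle as an element of the complex of homogeneous cochains. -/
def Cocycle.toCochain {n : ℕ} (σ : Cocycle R Γ n) :
    (TopRep.homogeneousCochains (triv R Γ)).X n :=
  (⟨σ.fn, σ.invariant⟩ : (Res R Γ (n + 1)).ρ.invariants)

theorem Cocycle.d_toCochain {n : ℕ} (σ : Cocycle R Γ n) :
    ((TopRep.homogeneousCochains (triv R Γ)).d n (n + 1)).hom σ.toCochain = 0 :=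
  Subtype.ext ((TopRep.homogeneousCochains.d_apply (triv R Γ) n σ.toCochain).trans σ.closed)

variable (R Γ) in
/-- The `n`-th continuous cohomology group of `Γ` with coefficients in the trivial module `R`. -/
abbrev HCont (n : ℕ) : TopModuleCat.{u} R := continuousCohomology n (triv R Γ)

variable (R Γ) in
/-- The cycles of the complex of homogeneous cochains are the kernel of the differential. -/
def cyclesIso (n : ℕ) : ContinuousCohomology.cocycles (triv R Γ) n ≅
    TopModuleCat.of R ((TopRep.homogeneousCochains (triv R Γ)).d n (n + 1)).hom.ker :=
  Limits.KernelFork.mapIsoOfIsLimit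
    ((TopRep.homogeneousCochains (triv R Γ)).cyclesIsKernel n (n + 1) (by simp))
    (TopModuleCat.isLimitKer _) (Iso.refl _)

/-- The cohomology class of a cocycle. -/
def Cocycle.cls {n : ℕ} (σ : Cocycle R Γ n) : HCont R Γ n :=
  (ContinuousCohomology.π (triv R Γ) n).hom
    ((cyclesIso R Γ n).inv.hom ⟨σ.toCochain, σ.d_toCochain⟩)

/-- The homogeneous cocycle `(g₀, g₁) ↦ a(g₀⁻¹ g₁)` representing the class in `H¹(Γ, R)` of a
continuous homomorphism `a` from `Γ` to the additive group of `R`. -/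
def homCocycle (a : Γ →ₜ* Multiplicative R) : Cocycle R Γ 1 where
  fn := (ContinuousMap.curry ⟨fun p : Γ × Γ => ULift.up.{u} (Multiplicative.toAdd (a (p.1⁻¹ * p.2))),
    continuous_uliftUp.comp (continuous_toAdd.comp
      (a.continuous_toFun.comp (continuous_fst.inv.mul continuous_snd)))⟩ :
      C(Γ, C(Γ, ULift.{u} R)))
  invariant γ := by
    refine ev_ext fun g => ev_ext fun g' => ?_
    change ULift.up (Multiplicative.toAdd (a ((γ⁻¹ * g)⁻¹ * (γ⁻¹ * g')))) =
      ULift.up (Multiplicative.toAdd (a (g⁻¹ * g')))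
    congr 3
    group
  closed := by
    refine ev_ext fun g => ev_ext fun g' => ev_ext fun g'' => ?_
    change ULift.up (Multiplicative.toAdd (a (g'⁻¹ * g''))) -
      (ULift.up (Multiplicative.toAdd (a (g⁻¹ * g''))) -
        ULift.up (Multiplicative.toAdd (a (g⁻¹ * g')))) = ULift.up.{u} (0 : R)
    have h : a (g⁻¹ * g'') = a (g⁻¹ * g') * a (g'⁻¹ * g'') := by
      rw [← map_mul]
      group
    rw [h, toAdd_mul]
    refine ULift.down_injective ?_
    change _ - (_ - _) = (0 : R)
    ring

variable [LocallyCompactSpace Γ]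

/-- For `σ` a function of one variable and `τ` a function of `n + 1` variables, the function
`(g₀, …, gₙ) ↦ σ(g₀) τ(g₀, …, gₙ)`. -/
def cup₀ {n : ℕ} (τ : Res R Γ (n + 1)) : Res R Γ 1 →L[R] Res R Γ (n + 1) where
  toFun σ := (⟨fun g => ULift.down (ev σ g) • ev τ g,
    (continuous_uliftDown.comp (ContinuousMap.continuous (X := Γ) (Y := ULift.{u} R) σ)).smul
      (ContinuousMap.continuous (X := Γ) (Y := Res R Γ n) τ)⟩ : C(Γ, Res R Γ n))
  map_add' σ σ' := ev_ext fun g => add_smul (ULift.down (ev σ g)) (ULift.down (ev σ' g)) (ev τ g)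
  map_smul' r σ := ev_ext fun g => mul_smul r (ULift.down (ev σ g)) (ev τ g)
  cont := by
    have h : Continuous fun p : ULift.{u} R × Res R Γ n => ULift.down p.1 • p.2 :=
      (continuous_uliftDown.comp continuous_fst).smul continuous_snd
    have h2 : Continuous fun p : C(Γ, ULift.{u} R) × Γ => (p.1 p.2, ev τ p.2) :=
      ContinuousEval.continuous_eval.prodMk
        ((ContinuousMap.continuous (X := Γ) (Y := Res R Γ n) τ).comp continuous_snd)
    exact ContinuousMap.continuous_of_continuous_uncurry _ (h.comp h2)

/-- The Alexander–Whitney cup product of homogeneous cochains: for `σ` a function of `m + 1`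
variables and `τ` a function of `n + 1` variables it is
`(g₀, …, g_{m + n}) ↦ σ(g₀, …, gₘ) τ(gₘ, …, g_{m + n})`. -/
def cup {n : ℕ} (τ : Res R Γ (n + 1)) : (m : ℕ) → Res R Γ (m + 1) →L[R] Res R Γ (n + m + 1)
  | 0 => cup₀ τ
  | m + 1 => (cup τ m).compLeftContinuous R Γ

theorem ev_cup_zero {n : ℕ} (σ : Res R Γ 1) (τ : Res R Γ (n + 1)) (g : Γ) :
    ev (cup τ 0 σ : Res R Γ (n + 1)) g = ULift.down (ev σ g) • ev τ g := rfl

theorem ev_cup_succ {m n : ℕ} (σ : Res R Γ (m + 2)) (τ : Res R Γ (n + 1)) (g : Γ) :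
    ev (cup τ (m + 1) σ : Res R Γ (n + m + 2)) g = cup τ m (ev σ g) := rfl

theorem cup_ρ {n : ℕ} (τ : Res R Γ (n + 1)) (γ : Γ) (m : ℕ) (σ : Res R Γ (m + 1)) :
    cup ((Res R Γ (n + 1)).ρ γ τ) m ((Res R Γ (m + 1)).ρ γ σ) =
      (Res R Γ (n + m + 1)).ρ γ (cup τ m σ) := by
  induction m with
  | zero =>
    refine ev_ext fun g => ?_
    erw [ev_cup_zero, ev_ρ, ev_ρ, ev_ρ, ev_cup_zero, map_smul]
    rfl
  | succ m ih =>
    refine ev_ext fun g => ?_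
    exact ih (ev σ (γ⁻¹ * g))

theorem cup_add_right {n : ℕ} (τ τ' : Res R Γ (n + 1)) (m : ℕ) (σ : Res R Γ (m + 1)) :
    cup (τ + τ') m σ = cup τ m σ + cup τ' m σ := by
  induction m with
  | zero => exact ev_ext fun g => smul_add (ULift.down (ev σ g)) (ev τ g) (ev τ' g)
  | succ m ih => exact ev_ext fun g => ih (ev σ g)

theorem cup_zero_right {n : ℕ} (m : ℕ) (σ : Res R Γ (m + 1)) :
    cup (0 : Res R Γ (n + 1)) m σ = 0 := by
  have := cup_add_right (0 : Res R Γ (n + 1)) 0 m σ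
  simpa using this

/-- A case of the Leibniz rule: `d(σ ∪ τ) = dσ ∪ τ` if `dτ = 0`. -/
theorem d_cup {n : ℕ} (τ : Res R Γ (n + 1)) (hτ : ((triv R Γ).d (n + 1)).hom τ = 0)
    (m : ℕ) (σ : Res R Γ (m + 1)) :
    ((triv R Γ).d (n + m + 1)).hom (cup τ m σ) =
      (cup τ (m + 1) (((triv R Γ).d (m + 1)).hom σ) : Res R Γ (n + m + 2)) := by
  induction m with
  | zero =>
    refine ev_ext fun g => ?_
    have h : ((triv R Γ).d n).hom (ev τ g) = τ := by
      have := congrArg (fun f => ev f g) hτ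
      exact (sub_eq_zero.1 this).symm
    rw [ev_d, ev_cup_succ, ev_d, map_sub]
    congr 1
    erw [ev_cup_zero, map_smul, h]
    exact ev_ext fun x => rfl
  | succ m ih =>
    refine ev_ext fun g => ?_
    have h : ev (cup τ (m + 2) (((triv R Γ).d (m + 2)).hom σ) : Res R Γ (n + m + 3)) g =
        cup τ (m + 1) (σ - ((triv R Γ).d (m + 1)).hom (ev σ g)) := rfl
    rw [map_sub, ← ih] at h
    exact h.symm

/-- The cup product of cocycles. -/
def Cocycle.cup {m n : ℕ} (σ : Cocycle R Γ m) (τ : Cocycle R Γ n) : Cocycle R Γ (n + m) where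
  fn := EmbeddingObstruction.cup τ.fn m σ.fn
  invariant := by
    rw [ContRepresentation.mem_invariants]
    intro γ
    rw [← cup_ρ, (ContRepresentation.mem_invariants _).1 τ.invariant γ, (ContRepresentation.mem_invariants _).1 σ.invariant γ]
  closed := by
    rw [d_cup _ τ.closed, σ.closed, map_zero]

end Continuous

section Finite

/-- The map of trivial modules induced by a homomorphism of abelian groups. -/
def trivMap {P Q : Type} [Group P] [Group Q] (φ : P →* Q) {A B : Type} [AddCommGroup A]
    [AddCommGroup B] (s : A →+ B) : Rep.trivial ℤ P A ⟶ Rep.res φ (Rep.trivial ℤ Q B) :=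
  Rep.ofHom (σ := (Rep.res φ (Rep.trivial ℤ Q B)).ρ) ⟨s.toIntLinearMap, fun _ => rfl⟩

/-- The homology group `H₂(P, A)` with coefficients in the trivial module `A`. -/
abbrev H₂ (P : Type) [Group P] (A : Type) [AddCommGroup A] : ModuleCat ℤ :=
  groupHomology (Rep.trivial ℤ P A) 2

/-- The map `H₂(P, A) → H₂(Q, B)` induced by `φ : P → Q` and `s : A → B`. -/
def H₂map {P Q : Type} [Group P] [Group Q] (φ : P →* Q) {A B : Type} [AddCommGroup A]
    [AddCommGroup B] (s : A →+ B) : H₂ P A →ₗ[ℤ] H₂ Q B :=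
  (groupHomology.map φ (trivMap φ s) 2).hom

theorem H₂map_comp {P Q S : Type} [Group P] [Group Q] [Group S] (φ : P →* Q) (ψ : Q →* S)
    {A : Type} [AddCommGroup A] :
    H₂map (ψ.comp φ) (AddMonoidHom.id A) = H₂map ψ (.id A) ∘ₗ H₂map φ (.id A) := by
  unfold H₂map
  rw [← ModuleCat.hom_comp, ← groupHomology.map_comp]
  rfl

theorem H₂map_id {P : Type} [Group P] {A : Type} [AddCommGroup A] :
    H₂map (.id P) (AddMonoidHom.id A) = .id := by
  have := congrArg ModuleCat.Hom.hom (groupHomology.map_id (A := Rep.trivial ℤ P A) (n := 2))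
  exact this

open groupHomology in
/-- Inner automorphisms of `P` act trivially on `H₂(P, A)`. -/
theorem H₂map_inner {P : Type} [Group P] {A : Type} [AddCommGroup A] (p : P) :
    H₂map (MulAut.conj p).toMonoidHom (AddMonoidHom.id A) = .id := by
  classical
  let A' := Rep.trivial ℤ P A
  let c : P → P := fun x => p * x * p⁻¹
  let h₁ : (P →₀ A) →ₗ[ℤ] (P × P →₀ A) :=
    Finsupp.lsum ℤ fun x => Finsupp.lsingle (p, x) - Finsupp.lsingle (c x, p)
  let h₂ : (P × P →₀ A) →ₗ[ℤ] (P × P × P →₀ A) :=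
    Finsupp.lsum ℤ fun x => Finsupp.lsingle (p, x.1, x.2) - Finsupp.lsingle (c x.1, p, x.2)
      + Finsupp.lsingle (c x.1, c x.2, p)
  have key : ∀ z : P × P →₀ A, (d₃₂ A').hom (h₂ z) =
      z - Finsupp.mapDomain (Prod.map c c) z - h₁ ((d₂₁ A').hom z) := by
    intro z
    induction z using Finsupp.induction_linear with
    | zero => simp
    | add x y hx hy =>
      simp only [map_add, hx, hy, Finsupp.mapDomain_add]
      abel
    | single x a =>
      have e : ∀ y, c y * p = p * y := fun y => by simp [c]
      have e' : ∀ y y', c (y * y') = c y * c y' := fun y y' => by simp [c]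
      simp only [h₁, h₂, d₃₂, d₂₁, ModuleCat.hom_ofHom, Finsupp.lsum_single, LinearMap.add_apply,
        LinearMap.sub_apply, LinearMap.comp_apply, Finsupp.lsingle_apply, map_add, map_sub,
        Representation.isTrivial_def, LinearMap.id_apply, Finsupp.mapDomain_single, Prod.map, e, e']
      abel
  refine LinearMap.ext fun x => ?_
  induction x using H2_induction_on with | h x => ?_
  have h := H2π_comp_map_apply (MulAut.conj p).toMonoidHom
    (trivMap (MulAut.conj p).toMonoidHom (AddMonoidHom.id A)) x
  refine h.trans ?_
  rw [LinearMap.id_apply, H2π_eq_iff, ← neg_mem_iff]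
  refine ⟨h₂ x.1, (key x.1).trans ?_⟩
  have hx : (d₂₁ A').hom x.1 = 0 := x.2
  rw [hx, map_zero, sub_zero, neg_sub, coe_mapCycles₂]
  congr 1
  change _ = Finsupp.mapRange.linearMap _ (Finsupp.lmapDomain A ℤ _ x.1)
  rw [Finsupp.lmapDomain_apply]
  refine (Finsupp.mapRange_id _).symm.trans ?_
  rfl

variable {G H : Type} [Group G] [Group H]

theorem toMonoidHom_one (P : Type) [Group P] :
    (1 : MulAut P).toMonoidHom = .id P := rfl

theorem toMonoidHom_mul {P : Type} [Group P] (e e' : MulAut P) :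
    (e * e').toMonoidHom = e.toMonoidHom.comp e'.toMonoidHom := rfl

/-- The action of `G` on `H₂(P, A)`, `P` a normal subgroup of `G`, induced by conjugation. -/
def conjH₂ (P : Subgroup G) [P.Normal] (A : Type) [AddCommGroup A] :
    Representation ℤ G (H₂ P A) where
  toFun g := H₂map (MulAut.conjNormal g : MulAut P).toMonoidHom (.id A)
  map_one' := by
    rw [map_one, toMonoidHom_one]
    exact H₂map_id
  map_mul' g g' := by
    rw [map_mul, toMonoidHom_mul, H₂map_comp]
    rfl

theorem ker_le_ker_conjH₂ (f : G →* H) (A : Type) [AddCommGroup A] :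
    f.ker ≤ (conjH₂ f.ker A).toHomUnits.ker := fun p hp => by
  rw [MonoidHom.mem_ker]
  refine Units.ext ?_
  refine Eq.trans ?_ (H₂map_inner (A := A) (⟨p, hp⟩ : f.ker))
  change H₂map _ _ = _
  congr 1

/-- The action of `H` on `H₂(ker f, A)`, for `f : G → H` surjective: `h` acts as conjugation by
any `g` with `f g = h`. -/
def outerH₂ {f : G →* H} (hf : Function.Surjective f) (A : Type) [AddCommGroup A] :
    Representation ℤ H (H₂ f.ker A) :=
  (Units.coeHom _).comp (f.liftOfSurjective hf ⟨(conjH₂ f.ker A).toHomUnits, ker_le_ker_conjH₂ f A⟩)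

theorem outerH₂_apply {f : G →* H} (hf : Function.Surjective f) (A : Type) [AddCommGroup A]
    (g : G) : outerH₂ hf A (f g) = conjH₂ f.ker A g := by
  have := f.liftOfRightInverse_comp_apply _ (Function.rightInverse_surjInv hf)
    ⟨(conjH₂ f.ker A).toHomUnits, ker_le_ker_conjH₂ f A⟩ g
  exact congrArg Units.val this

/-- `H₂(ker f, A)` as an `H`-module. -/
abbrev H₂Rep {f : G →* H} (hf : Function.Surjective f) (A : Type) [AddCommGroup A] : Rep ℤ H :=
  Rep.of (outerH₂ hf A)

/-- The element of `N` that is mapped to `e` by `N → E`, in an extension `1 → N → E → P → 1`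
(with a junk value if `e` does not lie over `1`). -/
def kernelPart {N E P : Type} [AddCommGroup N] [Group E] [Group P]
    (S : GroupExtension (Multiplicative N) E P) (e : E) : N :=
  Multiplicative.toAdd (Function.invFun S.inl e)

theorem inl_kernelPart {N E P : Type} [AddCommGroup N] [Group E] [Group P]
    (S : GroupExtension (Multiplicative N) E P) {e : E} (he : S.rightHom e = 1) :
    S.inl (Multiplicative.ofAdd (kernelPart S e)) = e := by
  have h : e ∈ S.inl.range := by rw [S.range_inl_eq_ker_rightHom]; exact he
  exact Function.invFun_eq h

/-- The factor set `u` of a section `s`: `s x * s y = u x y * s (x * y)`. -/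
def factorSet {N E P : Type} [AddCommGroup N] [Group E] [Group P]
    (S : GroupExtension (Multiplicative N) E P) (s : S.Section) (x y : P) : N :=
  kernelPart S (s x * s y * (s (x * y))⁻¹)

/-- `δ : H₂(P, ℤ) → N` is the homomorphism attached to the central extension
`1 → N → E → P → 1` by the universal coefficient map `H²(P, N) → Hom(H₂(P, ℤ), N)`, i.e. by
evaluating the factor set of a section on 2-cycles `∑ nᵢ [xᵢ | yᵢ]`. -/
def IsClassifiedBy {N E P : Type} [AddCommGroup N] [Group E] [Group P]
    (S : GroupExtension (Multiplicative N) E P) (δ : H₂ P ℤ → N) : Prop :=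
  ∀ (s : S.Section) (z : groupHomology.cycles₂ (Rep.trivial ℤ P ℤ)),
    δ (groupHomology.H2π (Rep.trivial ℤ P ℤ) z) =
      Finsupp.sum (z.1 : P × P →₀ ℤ) fun x n => n • factorSet S s x.1 x.2

/-- An `(A, a)`-obstruction crossed module associated to `f : G → H`, with `P = ker f`:
a central extension `1 → H₂(P, A) → C → P → 1` (the `a`-central extension) whose invariant
`H₂(P, ℤ) → H₂(P, A)` is induced by `ℤ → A`, `1 ↦ a`, and an action of `G` on `C`, compatible
with the actions of `G` on `H₂(P, A)` and on `P`, for which `C → P → G` is a crossed module. -/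
structure ObstructionCrossedModule (f : G →* H) (A : Type) [AddCommGroup A] (a : A) where
  /-- The middle group of the extension. -/
  C : Type
  [group : Group C]
  /-- The extension `1 → H₂(P, A) → C → P → 1`. -/
  ext : GroupExtension (Multiplicative (H₂ f.ker A)) C f.ker
  /-- The extension is central. -/
  central : ext.inl.range ≤ Subgroup.center C
  /-- The extension is the `a`-central extension. -/
  classified : IsClassifiedBy ext (H₂map (.id f.ker) (zmultiplesHom A a))
  /-- The action of `G` on `C`. -/
  act : G →* MulAut C
  act_inl (g : G) (m : H₂ f.ker A) :
    act g (ext.inl (Multiplicative.ofAdd m)) = ext.inl (Multiplicative.ofAdd (conjH₂ f.ker A g m))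
  act_rightHom (g : G) (c : C) : (ext.rightHom (act g c) : G) = g * ext.rightHom c * g⁻¹
  peiffer (c c' : C) : act (ext.rightHom c : G) c' = c * c' * c⁻¹

namespace ObstructionCrossedModule

variable {f : G →* H} {A : Type} [AddCommGroup A] {a : A} (D : ObstructionCrossedModule f A a)

instance : Group D.C := D.group

/-- The boundary map `C → G`. -/
def bd : D.C →* G := f.ker.subtype.comp D.ext.rightHom

theorem bd_act (g : G) (c : D.C) : D.bd (D.act g c) = g * D.bd c * g⁻¹ := D.act_rightHom g c

theorem act_bd (c c' : D.C) : D.act (D.bd c) c' = c * c' * c⁻¹ := D.peiffer c c'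

theorem inl_pre {c : D.C} (hc : D.bd c = 1) :
    D.ext.inl (Multiplicative.ofAdd (kernelPart D.ext c)) = c :=
  inl_kernelPart D.ext (Subtype.ext hc)

/-- The choices needed to write down a 3-cocycle of the crossed module: a map `s : H → G` with
`f ∘ s = id`, and a lift `F : H × H → C` of its factor set. -/
structure Lift where
  /-- A set-theoretic section of `f`. -/
  s : H → G
  f_s (h : H) : f (s h) = h
  /-- A lift to `C` of the factor set of `s`. -/
  F : H → H → D.C
  bd_F (g h : H) : s g * s h = D.bd (F g h) * s (g * h)

variable {D}

/-- The element of `ker (C → G)` given by `ˢ⁽ᵍ⁾F(h, k) F(g, hk) = elt(g, h, k) F(g, h) F(gh, k)`. -/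
def Lift.elt (l : D.Lift) (g h k : H) : D.C :=
  D.act (l.s g) (l.F h k) * l.F g (h * k) * (l.F g h * l.F (g * h) k)⁻¹

theorem Lift.bd_elt (l : D.Lift) (g h k : H) : D.bd (l.elt g h k) = 1 := by
  have e1 : ∀ g h, D.bd (l.F g h) = l.s g * l.s h * (l.s (g * h))⁻¹ := fun g h => by
    rw [l.bd_F]; group
  simp only [elt, map_mul, map_inv, bd_act, e1, mul_assoc]
  group

/-- The 3-cochain of `H` with values in `H₂(P, A) = ker (C → G)` defined by `Lift.elt`. -/
def Lift.cochain (l : D.Lift) (x : Fin 3 → H) : H₂ f.ker A :=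
  kernelPart D.ext (l.elt (x 0) (x 1) (x 2))

theorem Lift.elt_mul (l : D.Lift) (g h k : H) :
    l.elt g h k * (l.F g h * l.F (g * h) k) = D.act (l.s g) (l.F h k) * l.F g (h * k) := by
  simp only [elt]
  group

theorem Lift.elt_comm (l : D.Lift) (g h k : H) (c : D.C) :
    c * l.elt g h k = l.elt g h k * c := by
  refine Subgroup.mem_center_iff.1 (D.central ?_) c
  exact ⟨_, D.inl_pre (l.bd_elt g h k)⟩

theorem Lift.act_act (l : D.Lift) (g h : H) (c : D.C) :
    D.act (l.s g) (D.act (l.s h) c) * l.F g h = l.F g h * D.act (l.s (g * h)) c := by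
  rw [← MulAut.mul_apply, ← map_mul, l.bd_F, map_mul, MulAut.mul_apply, act_bd]
  group

theorem Lift.elt_cocycle (l : D.Lift) (g h k m : H) :
    D.act (l.s g) (l.elt h k m) * l.elt g (h * k) m * l.elt g h k =
      l.elt (g * h) k m * l.elt g h (k * m) := by
  refine mul_right_cancel (b := l.F g h * l.F (g * h) k * l.F (g * h * k) m) ?_
  have h1 := congrArg (fun c => D.act (l.s g) c * l.F g (h * (k * m))) (l.elt_mul h k m)
  have h2 := l.elt_mul g (h * k) m
  have h3 := l.elt_mul g h k
  have h4 := l.elt_mul g h (k * m)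
  have h5 := l.elt_mul (g * h) k m
  have h6 := l.act_act g h (l.F k m)
  simp only [map_mul, mul_assoc] at h1 h2 h3 h4 h5 h6 ⊢
  calc
    _ = D.act (l.s g) (l.elt h k m) * (l.elt g (h * k) m *
          ((l.elt g h k * (l.F g h * l.F (g * h) k)) * l.F (g * (h * k)) m)) := by
        simp only [mul_assoc]
    _ = D.act (l.s g) (l.elt h k m) * ((l.elt g (h * k) m * D.act (l.s g) (l.F h k)) *
          (l.F g (h * k) * l.F (g * (h * k)) m)) := by
        rw [h3]; simp only [mul_assoc]
    _ = D.act (l.s g) (l.elt h k m) * (D.act (l.s g) (l.F h k) *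
          (l.elt g (h * k) m * (l.F g (h * k) * l.F (g * (h * k)) m))) := by
        rw [← l.elt_comm]; simp only [mul_assoc]
    _ = D.act (l.s g) (D.act (l.s h) (l.F k m)) *
          (D.act (l.s g) (l.F h (k * m)) * l.F g (h * (k * m))) := by
        rw [h2, h1]
    _ = (D.act (l.s g) (D.act (l.s h) (l.F k m)) * l.elt g h (k * m)) *
          (l.F g h * l.F (g * h) (k * m)) := by
        rw [← h4]; simp only [mul_assoc]
    _ = l.elt g h (k * m) * ((D.act (l.s g) (D.act (l.s h) (l.F k m)) * l.F g h) *
          l.F (g * h) (k * m)) := by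
        rw [l.elt_comm]; simp only [mul_assoc]
    _ = l.elt g h (k * m) * (l.F g h * (l.elt (g * h) k m *
          (l.F (g * h) k * l.F (g * (h * k)) m))) := by
        rw [h6, h5]; simp only [mul_assoc]
    _ = (l.elt g h (k * m) * (l.F g h * l.elt (g * h) k m)) *
          (l.F (g * h) k * l.F (g * (h * k)) m) := by
        simp only [mul_assoc]
    _ = _ := by
        rw [l.elt_comm, ← mul_assoc (l.elt g h (k * m)), l.elt_comm]; simp only [mul_assoc]

theorem Lift.cocycle (l : D.Lift) (hf : Function.Surjective f) :
    inhomogeneousCochains.d (H₂Rep hf A) 3 l.cochain = 0 := by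
  funext x
  have hinj : Function.Injective fun m : H₂ f.ker A => D.ext.inl (Multiplicative.ofAdd m) :=
    D.ext.inl_injective.comp Multiplicative.ofAdd.injective
  have hc : ∀ g h k, D.ext.inl (Multiplicative.ofAdd (kernelPart D.ext (l.elt g h k))) = l.elt g h k :=
    fun g h k => D.inl_pre (l.bd_elt g h k)
  have hρ : outerH₂ hf A (x 0) = conjH₂ f.ker A (l.s (x 0)) := by
    rw [← outerH₂_apply hf, l.f_s]
  have key : conjH₂ f.ker A (l.s (x 0)) (kernelPart D.ext (l.elt (x 1) (x 2) (x 3))) +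
      kernelPart D.ext (l.elt (x 0) (x 1 * x 2) (x 3)) + kernelPart D.ext (l.elt (x 0) (x 1) (x 2)) =
      kernelPart D.ext (l.elt (x 0 * x 1) (x 2) (x 3)) + kernelPart D.ext (l.elt (x 0) (x 1) (x 2 * x 3)) := by
    refine hinj ?_
    simp only [ofAdd_add, map_mul, hc, ← D.act_inl]
    exact l.elt_cocycle _ _ _ _
  rw [inhomogeneousCochains.d_hom_apply]
  change outerH₂ hf A (x 0) _ + _ = _
  rw [hρ, Fin.sum_univ_four]
  simp [Lift.cochain, Fin.contractNth]
  refine Eq.trans ?_ (sub_eq_zero.2 key)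
  erw [one_smul, one_smul, one_smul, one_smul]
  abel

theorem nonempty_lift (D : ObstructionCrossedModule f A a) (hf : Function.Surjective f) :
    Nonempty D.Lift := by
  have h1 := fun h => hf h
  choose s hs using h1
  have h2 : ∀ g h, ∃ c, D.bd c = s g * s h * (s (g * h))⁻¹ := fun g h => by
    obtain ⟨c, hc⟩ := D.ext.rightHom_surjective ⟨s g * s h * (s (g * h))⁻¹, by
      simp [MonoidHom.mem_ker, hs]⟩
    exact ⟨c, congrArg Subtype.val hc⟩
  choose F hF using h2
  exact ⟨⟨s, hs, F, fun g h => by rw [hF]; group⟩⟩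

/-- The class in `H³(H, H₂(ker f, A))` which classifies the crossed module. It does not depend on
the chosen lift. -/
def cls (D : ObstructionCrossedModule f A a) (hf : Function.Surjective f) :
    groupCohomology (H₂Rep hf A) 3 :=
  groupCohomology.π (H₂Rep hf A) 3
    (groupCohomology.cocyclesMk (D.nonempty_lift hf).some.cochain
      ((D.nonempty_lift hf).some.cocycle hf))

end ObstructionCrossedModule

/-- `P` is `A`-perfect: `Pᵃᵇ ⊗ A = 0`. -/
def IsPerfectFor (A : Type) [AddCommGroup A] (P : Type) [Group P] : Prop :=
  Subsingleton (TensorProduct ℤ (Additive (Abelianization P)) A)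

open Classical in
/-- The `(A, a)`-obstruction in `H³(H, H₂(ker f, A))` to the existence of a section of the
surjection `f : G → H`: the class of the obstruction crossed module associated to `f`. If `ker f` is
`A`-perfect (and `G` finite, `A` finitely generated), such a crossed module exists and is unique up
to isomorphism, so the choice is immaterial and the value `0` in the other case is not used. -/
def obstruction {f : G →* H} (hf : Function.Surjective f) (A : Type) [AddCommGroup A] (a : A) :
    groupCohomology (H₂Rep hf A) 3 :=
  if h : Nonempty (ObstructionCrossedModule f A a) then h.some.cls hf else 0

/-- The cup product of inhomogeneous cochains of `H` with values in the trivial module `R`. -/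
def cochainCup {R : Type} [CommRing R] {m n : ℕ} (φ : (Fin m → H) → R) (ψ : (Fin n → H) → R) :
    (Fin (m + n) → H) → R :=
  fun x => φ (fun i => x (Fin.castAdd n i)) * ψ (fun j => x (Fin.natAdd m j))

/-- The 1-cocycle of `H` given by a homomorphism to the additive group of `R`. -/
def homCochain {R : Type} [CommRing R] (a : H →* Multiplicative R) : (Fin 1 → H) → R :=
  fun x => Multiplicative.toAdd (a (x 0))

theorem d_cup_homCochain {R : Type} [CommRing R] (a b c : H →* Multiplicative R) :
    inhomogeneousCochains.d (Rep.trivial ℤ H R) 3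
      (cochainCup (cochainCup (homCochain a) (homCochain b)) (homCochain c)) = 0 := by
  funext x
  rw [inhomogeneousCochains.d_hom_apply]
  rw [Fin.sum_univ_four, Representation.isTrivial_def, LinearMap.id_apply]
  simp [cochainCup, homCochain, Fin.contractNth]
  refine Eq.trans ?_ (Pi.zero_apply (M := fun _ => R) x).symm
  ring

/-- The class of `a ∪ b ∪ c` in `H³(H, R)`, for `a, b, c ∈ H¹(H, R) = Hom(H, R)`. -/
def cupClass {R : Type} [CommRing R] (a b c : H →* Multiplicative R) :
    groupCohomology (Rep.trivial ℤ H R) 3 :=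
  groupCohomology.π (Rep.trivial ℤ H R) 3
    (groupCohomology.cocyclesMk
      (cochainCup (cochainCup (homCochain a) (homCochain b)) (homCochain c))
      (d_cup_homCochain a b c))

end Finite

section Properties

/-- The group `ℤ/2ℤ`, written multiplicatively. -/
abbrev C₂ : Type := Multiplicative (ZMod 2)

variable {Γ : Type u} [Group Γ] [TopologicalSpace Γ] [IsTopologicalGroup Γ] [LocallyCompactSpace Γ]

/-- The cup product `x ∪ y ∪ z ∈ H³(Γ, ℤ/2ℤ)` in continuous cohomology of the classes
`x, y, z ∈ H¹(Γ, ℤ/2ℤ)` of three continuous homomorphisms. -/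
def contCupClass (x y z : Γ →ₜ* C₂) : HCont (ZMod 2) Γ 3 :=
  (((homCocycle x).cup (homCocycle y)).cup (homCocycle z)).cls

/-- The pullback along `p : Γ → H` of the class in `H¹(H, ℤ/2ℤ)` of the homomorphism `a`. -/
def pullback {H : Type} [Group H] [TopologicalSpace H] [DiscreteTopology H] (p : Γ →ₜ* H)
    (a : H →* C₂) : Γ →ₜ* C₂ where
  toMonoidHom := a.comp p.toMonoidHom
  continuous_toFun := (continuous_of_discreteTopology (f := a)).comp p.continuous_toFun

/-- A continuous homomorphism `q : Γ → G` with `f ∘ q = p` exists, i.e. the embedding problem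
`(f, p)` has a (weak) solution. -/
def HasSolution {G H : Type} [Group G] [TopologicalSpace G] [Group H] [TopologicalSpace H]
    (f : G →* H) (p : Γ →ₜ* H) : Prop :=
  ∃ q : Γ →ₜ* G, ∀ γ, f (q γ) = p γ

/-- Under some identification `H₂(ker f, ℤ/2ℤ) = ℤ/2ℤ`, the `ℤ/2ℤ`-obstruction of the surjection
`f : G → ℤ/2ℤ × ℤ/2ℤ` is `a² ∪ b`. -/
def ObstructionEqCup {G : Type} [Group G] {f : G →* C₂ × C₂} (hf : Function.Surjective f)
    (a b : C₂ × C₂ →* C₂) : Prop :=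
  ∃ φ : H₂Rep hf (ZMod 2) ≅ Rep.trivial ℤ (C₂ × C₂) (ZMod 2),
    ((groupCohomology.functor ℤ (C₂ × C₂) 3).map φ.hom).hom (obstruction hf (ZMod 2) 1) =
      cupClass a a b

/-- Property `(∗)ₐ` of a finite group. -/
def PropertyStarA (G : Type) [Group G] : Prop :=
  ∃ (f : G →* C₂) (hf : Function.Surjective f),
    Odd (Nat.card (Abelianization f.ker)) ∧ obstruction hf (ZMod 2) 1 ≠ 0

/-- Property `(∗)_b` of a finite group. -/
def PropertyStarB (G : Type) [Group G] : Prop :=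
  ∃ (f : G →* C₂ × C₂) (hf : Function.Surjective f),
    Odd (Nat.card (Abelianization f.ker)) ∧
    Nonempty (H₂ f.ker (ZMod 2) ≃+ ZMod 2) ∧
    ∃ a b : C₂ × C₂ →* C₂, a ≠ 1 ∧ b ≠ 1 ∧ a ≠ b ∧ ObstructionEqCup hf a b

variable (Γ) in
/-- Property `(∗∗)ₐ` of a profinite group. -/
def PropertyStarStarA : Prop :=
  ∀ x : Γ →ₜ* C₂, Function.Surjective x → contCupClass x x x ≠ 0

variable (Γ) in
/-- Property `(∗∗)_b` of a profinite group. -/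
def PropertyStarStarB : Prop :=
  ∀ x y : Γ →ₜ* C₂, Function.Surjective x → Function.Surjective y → x ≠ y →
    contCupClass x x y ≠ 0

end Properties

end EmbeddingObstruction

end

noncomputable section

namespace EmbeddingObstruction

/-! ### Vanishing of classes in continuous cohomology. -/

section ContinuousClasses

variable {R : Type} [CommRing R] [TopologicalSpace R] [IsTopologicalRing R]
  {Γ : Type u} [Group Γ] [TopologicalSpace Γ] [IsTopologicalGroup Γ]

/-! The class of the crossed module dies when inflated along `f`. Over `H` the section `s` is
multiplicative only up to `d(F(g, h))`, but over `G` it can be corrected: choosing `u(g)` in `C`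
above `g s(f g)⁻¹` gives `d(u(g)) s(f g) = g`, which is multiplicative. The factor set corrected by
`u` therefore takes values in the kernel of `C → G`, and its coboundary is the inflated cocycle
(`Lift.exists_coboundary`). If `f ∘ q = p`, the pullback of the obstruction along `p` factors
through this inflation, so it vanishes. Applying an invariant map `φ` to `ℤ/2` that carries the
obstruction to `a ∪ b ∪ c` shows that `p*(a ∪ b ∪ c) = 0` (`contCupClass_pullback_eq_zero`).

Over `ℤ/2 × ℤ/2` the map `φ` is part of the hypothesis. Over `ℤ/2` it has to be constructed. For a
module `M` killed by 2, with `t` generating `C₂`, the group `H³(C₂, M)` is `ker(1 + t) / im(1 + t)`.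
A class that is non-zero there is detected by a functional `M → ℤ/2` vanishing on `im(1 + t)`; such
a functional is automatically invariant, and it sends the class to the cube of the generator
(`exists_hom_cohomologous_cube`).

The statements on surjections follow by taking `p = f ∘ q`. Neither the existence or uniqueness of
the crossed module nor independence of the lift is needed. -/

theorem cyclesIso_hom_apply {n : ℕ} (z : ContinuousCohomology.cocycles (triv R Γ) n) :
    (((cyclesIso R Γ n).hom.hom z).1 : (TopRep.homogeneousCochains (triv R Γ)).X n) =
      ((TopRep.homogeneousCochains (triv R Γ)).iCycles n).hom z := by
  have h := Limits.KernelFork.mapOfIsLimit_ι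
    (Limits.KernelFork.ofι _ ((TopRep.homogeneousCochains (triv R Γ)).iCycles_d n (n + 1)))
    (TopModuleCat.isLimitKer ((TopRep.homogeneousCochains (triv R Γ)).d n (n + 1)))
    (𝟙 (Arrow.mk ((TopRep.homogeneousCochains (triv R Γ)).d n (n + 1))))
  exact congrArg (fun φ => φ.hom z) h

/-- A coboundary of an invariant cochain has trivial class. -/
theorem Cocycle.cls_eq_zero {n : ℕ} (σ : Cocycle R Γ (n + 1)) (τ : Res R Γ (n + 1))
    (hτ : τ ∈ (Res R Γ (n + 1)).ρ.invariants) (h : ((triv R Γ).d (n + 1)).hom τ = σ.fn) :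
    σ.cls = 0 := by
  let K := TopRep.homogeneousCochains (triv R Γ)
  let t : K.X n := (⟨τ, hτ⟩ : (Res R Γ (n + 1)).ρ.invariants)
  -- The cycle used to define the class is the boundary of `t`. This is checked in the explicit
  -- kernel of the differential and transported back along `cyclesIso`.
  have key : (cyclesIso R Γ (n + 1)).inv.hom ⟨σ.toCochain, σ.d_toCochain⟩ =
      (K.toCycles n (n + 1)).hom t := by
    have h1 : (⟨σ.toCochain, σ.d_toCochain⟩ :
        TopModuleCat.of R ((TopRep.homogeneousCochains (triv R Γ)).d (n + 1) (n + 2)).hom.ker) =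
        (cyclesIso R Γ (n + 1)).hom.hom ((K.toCycles n (n + 1)).hom t) := by
      refine Subtype.ext ?_
      rw [cyclesIso_hom_apply]
      refine Eq.trans ?_ (congrArg (fun φ => φ.hom t) (K.toCycles_i n (n + 1))).symm
      refine Subtype.ext ?_
      exact h.symm.trans (TopRep.homogeneousCochains.d_apply (triv R Γ) n t).symm
    rw [h1]
    exact congrArg (fun φ => φ.hom ((K.toCycles n (n + 1)).hom t))
      (cyclesIso R Γ (n + 1)).hom_inv_id
  unfold Cocycle.cls
  rw [key]
  exact congrArg (fun φ => φ.hom t) (K.toCycles_comp_homologyπ n (n + 1))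

variable {G : Type} [Group G] [TopologicalSpace G] [DiscreteTopology G]

/-- The homogeneous cochain `(g₀, g₁, g₂) ↦ e(q(g₀⁻¹ g₁), q(g₁⁻¹ g₂))`. -/
def inflatedCochain (q : Γ →ₜ* G) (e : G → G → R) : Res R Γ 3 :=
  (ContinuousMap.curry (ContinuousMap.curry
    ⟨fun p : (Γ × Γ) × Γ => ULift.up.{u} (e (q (p.1.1⁻¹ * p.1.2)) (q (p.1.2⁻¹ * p.2))), by
      have h1 : Continuous fun p : (Γ × Γ) × Γ => q (p.1.1⁻¹ * p.1.2) :=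
        q.continuous_toFun.comp (continuous_fst.fst.inv.mul continuous_fst.snd)
      have h2 : Continuous fun p : (Γ × Γ) × Γ => q (p.1.2⁻¹ * p.2) :=
        q.continuous_toFun.comp (continuous_fst.snd.inv.mul continuous_snd)
      exact continuous_uliftUp.comp
        ((continuous_of_discreteTopology (f := fun x : G × G => e x.1 x.2)).comp
          (h1.prodMk h2))⟩) : C(Γ, C(Γ, C(Γ, ULift.{u} R))))

theorem inflatedCochain_mem_invariants (q : Γ →ₜ* G) (e : G → G → R) :
    inflatedCochain q e ∈ (Res R Γ 3).ρ.invariants := by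
  intro γ
  refine ev_ext fun g => ev_ext fun g' => ev_ext fun g'' => ?_
  change ULift.up (e (q ((γ⁻¹ * g)⁻¹ * (γ⁻¹ * g'))) (q ((γ⁻¹ * g')⁻¹ * (γ⁻¹ * g'')))) =
    ULift.up (e (q (g⁻¹ * g')) (q (g'⁻¹ * g'')))
  congr 3 <;> group

variable [LocallyCompactSpace Γ]

/-- If `a ∪ b ∪ c` is the coboundary of a 2-cochain of the discrete group `G`, then its pullback
along a continuous homomorphism to `G` has trivial class. -/
theorem cls_cup_homCocycle_eq_zero (q : Γ →ₜ* G) (a b c : Γ →ₜ* Multiplicative R)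
    (a' b' c' : G → R) (ha : ∀ γ, (a γ).toAdd = a' (q γ)) (hb : ∀ γ, (b γ).toAdd = b' (q γ))
    (hc : ∀ γ, (c γ).toAdd = c' (q γ)) (e : G → G → R)
    (he : ∀ g h k, e h k - e (g * h) k + e g (h * k) - e g h = a' g * b' h * c' k) :
    (((homCocycle a).cup (homCocycle b)).cup (homCocycle c)).cls = 0 := by
  refine Cocycle.cls_eq_zero (n := 2) _ (inflatedCochain q e)
    (inflatedCochain_mem_invariants q e) ?_
  refine ev_ext fun g => ev_ext fun h => ev_ext fun k => ev_ext fun l => ?_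
  -- The recursive differential unfolds to nested differences, that is, to the usual alternating
  -- sum. In terms of the images under `q` of `g⁻¹h`, `h⁻¹k`, `k⁻¹l` it becomes the inhomogeneous
  -- identity `he`.
  change ULift.up (e (q (h⁻¹ * k)) (q (k⁻¹ * l))) - (ULift.up (e (q (g⁻¹ * k)) (q (k⁻¹ * l))) -
    (ULift.up (e (q (g⁻¹ * h)) (q (h⁻¹ * l))) - ULift.up (e (q (g⁻¹ * h)) (q (h⁻¹ * k))))) =
    ULift.up (((a (g⁻¹ * h)).toAdd * (b (h⁻¹ * k)).toAdd) * (c (k⁻¹ * l)).toAdd)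
  rw [ha, hb, hc, ← he]
  have h1 : q (g⁻¹ * k) = q (g⁻¹ * h) * q (h⁻¹ * k) := by rw [← map_mul]; group
  have h2 : q (h⁻¹ * l) = q (h⁻¹ * k) * q (k⁻¹ * l) := by rw [← map_mul]; group
  rw [h1, h2]
  refine ULift.down_injective ?_
  change _ - (_ - (_ - _)) = _
  ring

end ContinuousClasses

/-! ### Group cohomology classes in terms of explicit cochains. -/

section CohomologyClasses

variable {H : Type} [Group H]

theorem d_two_apply (A : Rep ℤ H) (e : (Fin 2 → H) → A) (g h k : H) :
    inhomogeneousCochains.d A 2 e ![g, h, k] =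
      A.ρ g (e ![h, k]) - e ![g * h, k] + e ![g, h * k] - e ![g, h] := by
  have h0 : (fun i : Fin 2 => ![g, h, k] i.succ) = ![h, k] := by
    funext i; fin_cases i <;> rfl
  have h1 : Fin.contractNth (0 : Fin 3) (· * ·) ![g, h, k] = ![g * h, k] := by
    funext i; fin_cases i <;> rfl
  have h2 : Fin.contractNth (1 : Fin 3) (· * ·) ![g, h, k] = ![g, h * k] := by
    funext i; fin_cases i <;> rfl
  have h3 : Fin.contractNth (2 : Fin 3) (· * ·) ![g, h, k] = ![g, h] := by
    funext i; fin_cases i <;> rfl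
  rw [inhomogeneousCochains.d_hom_apply, Fin.sum_univ_three, h0, h1, h2, h3]
  simp
  erw [one_smul, one_smul, one_smul]
  abel

theorem d_three_apply (A : Rep ℤ H) (c : (Fin 3 → H) → A) (g h k l : H) :
    inhomogeneousCochains.d A 3 c ![g, h, k, l] =
      A.ρ g (c ![h, k, l]) - c ![g * h, k, l] + c ![g, h * k, l] - c ![g, h, k * l] +
        c ![g, h, k] := by
  have h0 : (fun i : Fin 3 => ![g, h, k, l] i.succ) = ![h, k, l] := by
    funext i; fin_cases i <;> rfl
  have h1 : Fin.contractNth (0 : Fin 4) (· * ·) ![g, h, k, l] = ![g * h, k, l] := by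
    funext i; fin_cases i <;> rfl
  have h2 : Fin.contractNth (1 : Fin 4) (· * ·) ![g, h, k, l] = ![g, h * k, l] := by
    funext i; fin_cases i <;> rfl
  have h3 : Fin.contractNth (2 : Fin 4) (· * ·) ![g, h, k, l] = ![g, h, k * l] := by
    funext i; fin_cases i <;> rfl
  have h4 : Fin.contractNth (3 : Fin 4) (· * ·) ![g, h, k, l] = ![g, h, k] := by
    funext i; fin_cases i <;> rfl
  rw [inhomogeneousCochains.d_hom_apply, Fin.sum_univ_four, h0, h1, h2, h3, h4]
  simp
  erw [one_smul, one_smul, one_smul, one_smul]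
  abel

/-- Cohomology is the cokernel of cochains mapping to cocycles, which gives exactness at the
cocycles. -/
theorem exists_toCycles_eq {A : Rep ℤ H} {n : ℕ} {z : groupCohomology.cocycles A (n + 1)}
    (hz : groupCohomology.π A (n + 1) z = 0) :
    ∃ e, groupCohomology.toCocycles A n (n + 1) e = z := by
  let K := groupCohomology.inhomogeneousCochains A
  have h := ShortComplex.exact_of_g_is_cokernel
    (ShortComplex.mk _ _ (K.toCycles_comp_homologyπ n (n + 1)))
    (K.homologyIsCokernel n (n + 1) (by simp))
  exact (ShortComplex.moduleCat_exact_iff _).1 h z hz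

/-- Cocycles embed into cochains, so the given cocycle can be compared with the boundary of `e` at
the level of functions. -/
theorem π_cocyclesMk_eq_zero {A : Rep ℤ H} {n : ℕ} (c : (Fin (n + 1) → H) → A)
    (hc : inhomogeneousCochains.d A (n + 1) c = 0) (e : (Fin n → H) → A)
    (he : inhomogeneousCochains.d A n e = c) :
    groupCohomology.π A (n + 1) (groupCohomology.cocyclesMk c hc) = 0 := by
  let K := groupCohomology.inhomogeneousCochains A
  have h : groupCohomology.cocyclesMk c hc = groupCohomology.toCocycles A n (n + 1) e := by
    refine (ModuleCat.mono_iff_injective (K.iCycles (n + 1))).1 inferInstance ?_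
    refine (groupCohomology.iCocycles_mk c hc).trans ?_
    refine Eq.trans ?_ (congrArg (fun φ => φ.hom e) (K.toCycles_i n (n + 1))).symm
    rw [groupCohomology.inhomogeneousCochains.d_def]
    exact he.symm
  rw [h]
  exact congrArg (fun φ => φ.hom e) (K.toCycles_comp_homologyπ n (n + 1))

theorem exists_d_eq_of_π_eq_zero {A : Rep ℤ H} {n : ℕ} (c : (Fin (n + 1) → H) → A)
    (hc : inhomogeneousCochains.d A (n + 1) c = 0)
    (h : groupCohomology.π A (n + 1) (groupCohomology.cocyclesMk c hc) = 0) :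
    ∃ e, inhomogeneousCochains.d A n e = c := by
  obtain ⟨e, he⟩ := exists_toCycles_eq h
  refine ⟨e, ?_⟩
  rw [← groupCohomology.iCocycles_mk c hc, ← he, ← groupCohomology.inhomogeneousCochains.d_def]
  exact (congrArg (fun φ => φ.hom e)
    ((groupCohomology.inhomogeneousCochains A).toCycles_i n (n + 1))).symm

/-- This turns an equality of classes after a change of coefficients into a cochain identity: by
naturality the image class is represented by `φ ∘ c`, and two cocycles with equal classes differ by
a coboundary. -/
theorem exists_d_eq_of_map_π_eq {A B : Rep ℤ H} (φ : A ⟶ B) {n : ℕ}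
    (c : (Fin (n + 1) → H) → A) (hc : inhomogeneousCochains.d A (n + 1) c = 0)
    (c' : (Fin (n + 1) → H) → B) (hc' : inhomogeneousCochains.d B (n + 1) c' = 0)
    (h : ((groupCohomology.functor ℤ H (n + 1)).map φ).hom
        (groupCohomology.π A (n + 1) (groupCohomology.cocyclesMk c hc)) =
      groupCohomology.π B (n + 1) (groupCohomology.cocyclesMk c' hc')) :
    ∃ e, inhomogeneousCochains.d B n e = (fun x => φ.hom (c x)) - c' := by
  let K := groupCohomology.inhomogeneousCochains B
  let z := groupCohomology.cocyclesMap (MonoidHom.id H) φ (n + 1) (groupCohomology.cocyclesMk c hc)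
  have h1 : groupCohomology.π B (n + 1) z =
      groupCohomology.π B (n + 1) (groupCohomology.cocyclesMk c' hc') := by
    rw [← h]
    exact (congrArg (fun ψ => ψ.hom (groupCohomology.cocyclesMk c hc))
      (groupCohomology.π_map (MonoidHom.id H) φ (n + 1))).symm
  obtain ⟨e, he⟩ := exists_toCycles_eq (z := z - groupCohomology.cocyclesMk c' hc')
    (by rw [map_sub, h1, sub_self])
  refine ⟨e, ?_⟩
  have h2 := congrArg (fun y => groupCohomology.iCocycles B (n + 1) y) he
  have h3 : groupCohomology.iCocycles B (n + 1) (groupCohomology.toCocycles B n (n + 1) e) =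
      inhomogeneousCochains.d B n e := by
    refine (congrArg (fun φ => φ.hom e) (K.toCycles_i n (n + 1))).trans ?_
    rw [groupCohomology.inhomogeneousCochains.d_def]
  have h4 : groupCohomology.iCocycles B (n + 1) z = fun x => φ.hom (c x) := by
    refine (congrArg (fun ψ => ψ.hom (groupCohomology.cocyclesMk c hc))
      (HomologicalComplex.cyclesMap_i (groupCohomology.cochainsMap (MonoidHom.id H) φ)
        (n + 1))).trans ?_
    refine (congrArg ((groupCohomology.cochainsMap (MonoidHom.id H) φ).f (n + 1)).hom
      (groupCohomology.iCocycles_mk c hc)).trans ?_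
    rfl
  dsimp only at h2
  rw [map_sub, h3, h4, groupCohomology.iCocycles_mk] at h2
  exact h2

end CohomologyClasses

/-! ### Triviality of the crossed module class after inflation to `G`. -/

section CrossedModule

namespace ObstructionCrossedModule

variable {G H : Type} [Group G] [Group H] {f : G →* H} {A : Type} [AddCommGroup A] {a : A}
  {D : ObstructionCrossedModule f A a}

theorem inl_comm (m : H₂ f.ker A) (c : D.C) :
    c * D.ext.inl (Multiplicative.ofAdd m) = D.ext.inl (Multiplicative.ofAdd m) * c :=
  Subgroup.mem_center_iff.1 (D.central ⟨_, rfl⟩) c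

/-- The inflation to `G` of the cocycle of the crossed module is a coboundary. -/
theorem Lift.exists_coboundary (l : D.Lift) (hf : Function.Surjective f) :
    ∃ e : G → G → H₂ f.ker A, ∀ g h k,
      outerH₂ hf A (f g) (e h k) - e (g * h) k + e g (h * k) - e g h =
        l.cochain ![f g, f h, f k] := by
  -- Since `g` and `s(f g)` have the same image in `H`, their quotient lies in `ker f` and lifts to
  -- `C`.
  have hu : ∀ g, ∃ c, D.bd c * l.s (f g) = g := fun g => by
    obtain ⟨c, hc⟩ := D.ext.rightHom_surjective ⟨g * (l.s (f g))⁻¹, by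
      simp [MonoidHom.mem_ker, l.f_s]⟩
    exact ⟨c, by rw [show D.bd c = g * (l.s (f g))⁻¹ from congrArg Subtype.val hc]; group⟩
  choose u hu using hu
  have hu' : ∀ g, D.bd (u g) = g * (l.s (f g))⁻¹ := fun g => eq_mul_inv_of_mul_eq (hu g)
  -- This is the factor set `F` corrected by `u`. Its boundary is `g h (gh)⁻¹ = 1`, so it takes
  -- central values.
  let E : G → G → D.C := fun g h =>
    u g * D.act (l.s (f g)) (u h) * l.F (f g) (f h) * (u (g * h))⁻¹
  have bdF : ∀ g h, D.bd (l.F g h) = l.s g * l.s h * (l.s (g * h))⁻¹ := fun g h => by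
    rw [l.bd_F]; group
  have bdE : ∀ g h, D.bd (E g h) = 1 := fun g h => by
    simp only [E, map_mul, map_inv, D.bd_act, hu', bdF]
    group
  have hE : ∀ g h, D.ext.inl (Multiplicative.ofAdd (kernelPart D.ext (E g h))) = E g h :=
    fun g h => D.inl_pre (bdE g h)
  have Emul : ∀ g h, u g * (D.act (l.s (f g)) (u h) * l.F (f g) (f h)) = E g h * u (g * h) :=
    fun g h => by simp only [E]; group
  have Ecomm : ∀ g h c, c * E g h = E g h * c := fun g h c => by
    rw [← hE]; exact inl_comm _ _
  have hρ : ∀ g, outerH₂ hf A (f g) = conjH₂ f.ker A (l.s (f g)) := fun g => by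
    rw [← outerH₂_apply hf, l.f_s]
  -- This is the identity "coboundary of `E` equals the inflated cocycle" written multiplicatively
  -- in `C`. After multiplication by `u(ghk)` on the right, the factors `u` and `F` are regrouped by
  -- associativity, the elements `E` and `elt` being moved freely because they are central.
  have key : ∀ g h k, D.act (l.s (f g)) (E h k) * E g (h * k) =
      l.elt (f g) (f h) (f k) * (E g h * E (g * h) k) := fun g h k => by
    refine mul_right_cancel (b := u (g * h * k)) ?_
    have aEcomm : ∀ c, c * D.act (l.s (f g)) (E h k) = D.act (l.s (f g)) (E h k) * c := by
      intro c
      rw [← hE, D.act_inl]; exact inl_comm _ _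
    have e1 := congrArg (D.act (l.s (f g))) (Emul h k)
    have e2 := Emul g (h * k)
    have e3 := Emul g h
    have e4 := Emul (g * h) k
    have e5 := l.elt_mul (f g) (f h) (f k)
    have e6 := l.act_act (f g) (f h) (u k)
    have e7 := l.elt_comm (f g) (f h) (f k)
    simp only [map_mul, mul_assoc] at e1 e2 e3 e4 e5 e6 ⊢
    calc
      _ = D.act (l.s (f g)) (E h k) *
          (u g * (D.act (l.s (f g)) (u (h * k)) * l.F (f g) (f h * f k))) := by rw [e2]
      _ = u g * ((D.act (l.s (f g)) (E h k) * D.act (l.s (f g)) (u (h * k))) *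
          l.F (f g) (f h * f k)) := by
        simp only [← mul_assoc]; rw [aEcomm]
      _ = u g * (D.act (l.s (f g)) (u h) * (D.act (l.s (f g)) (D.act (l.s (f h)) (u k)) *
          (l.elt (f g) (f h) (f k) * (l.F (f g) (f h) * l.F (f g * f h) (f k))))) := by
        rw [← e1, e5]; simp only [mul_assoc]
      _ = l.elt (f g) (f h) (f k) * (u g * (D.act (l.s (f g)) (u h) *
          ((D.act (l.s (f g)) (D.act (l.s (f h)) (u k)) * l.F (f g) (f h)) *
            l.F (f g * f h) (f k)))) := by
        simp only [← mul_assoc]; simp only [e7]; simp only [mul_assoc]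
      _ = l.elt (f g) (f h) (f k) * ((u g * (D.act (l.s (f g)) (u h) * l.F (f g) (f h))) *
          (D.act (l.s (f g * f h)) (u k) * l.F (f g * f h) (f k))) := by
        rw [e6]; simp only [mul_assoc]
      _ = l.elt (f g) (f h) (f k) * (E g h * (u (g * h) *
          (D.act (l.s (f g * f h)) (u k) * l.F (f g * f h) (f k)))) := by
        rw [e3]; simp only [mul_assoc]
      _ = _ := by rw [e4]
  refine ⟨fun g h => kernelPart D.ext (E g h), fun g h k => ?_⟩
  have hinj : Function.Injective fun m : H₂ f.ker A => D.ext.inl (Multiplicative.ofAdd m) :=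
    D.ext.inl_injective.comp Multiplicative.ofAdd.injective
  have key' : outerH₂ hf A (f g) (kernelPart D.ext (E h k)) + kernelPart D.ext (E g (h * k)) =
      l.cochain ![f g, f h, f k] +
        (kernelPart D.ext (E g h) + kernelPart D.ext (E (g * h) k)) := by
    refine hinj ?_
    have hc : D.ext.inl (Multiplicative.ofAdd (l.cochain ![f g, f h, f k])) =
        l.elt (f g) (f h) (f k) := D.inl_pre (l.bd_elt _ _ _)
    simp only [hρ, ofAdd_add, map_mul, hc, hE, ← D.act_inl]
    exact key g h k
  rw [← sub_eq_zero] at key' ⊢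
  rw [← key']
  abel

end ObstructionCrossedModule

end CrossedModule

/-! ### Third cohomology of `C₂` with coefficients killed by 2. -/

section Torsion

/-- A 3-cocycle of `C₂` with values in a module killed by 2 is a coboundary as soon as the
invariant `c(t, t, t) + c(1, 1, t) + c(t, 1, 1)`, `t` the generator, is a norm. -/
theorem exists_coboundary_of_eq_norm {M : Type*} [AddCommGroup M] [Module ℤ M] (hM : ∀ m : M, m + m = 0)
    (ρ : Representation ℤ C₂ M) (c : C₂ → C₂ → C₂ → M)
    (hc : ∀ g h k l, ρ g (c h k l) - c (g * h) k l + c g (h * k) l - c g h (k * l) +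
      c g h k = 0) (n : M) (t : C₂) (ht : ∀ g, g = 1 ∨ g = t) (ht1 : t ≠ 1) (htt : t * t = 1)
    (hn : c t t t + c 1 1 t + c t 1 1 = ρ t n + n) :
    ∃ e : C₂ → C₂ → M, ∀ g h k,
      ρ g (e h k) - e (g * h) k + e g (h * k) - e g h = c g h k := by
  have hneg : ∀ m : M, -m = m := fun m => neg_eq_of_add_eq_zero_left (hM m)
  -- Once `e(1, 1) = 0` is imposed, the equations at `(1, 1, t)` and `(t, 1, 1)` force `e(1, t)` and
  -- `e(t, 1)`, signs being irrelevant. The equation at `(t, t, t)` then asks exactly that `e(t, t)`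
  -- be a preimage `n` under the norm.
  refine ⟨fun g h => if g = 1 then (if h = 1 then 0 else c 1 1 t) else
    if h = 1 then c t 1 1 else n, fun g h k => ?_⟩
  -- These five instances of the cocycle identity express the values of `c` at the five remaining
  -- triples through `c(1, 1, t)` and `c(t, 1, 1)`.
  have h111 := hc 1 1 1 1
  have h1t1 := hc 1 t 1 1
  have h1tt := hc 1 1 t t
  have ht1t := hc t 1 1 t
  have htt1 := hc t t 1 1
  simp only [map_one, Module.End.one_apply, mul_one, one_mul, htt, sub_self, zero_add,
    sub_add_cancel] at h111 h1t1 h1tt ht1t htt1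
  rcases ht g with rfl | rfl <;> rcases ht h with rfl | rfl <;> rcases ht k with rfl | rfl <;>
    simp [ht1, htt, h111, h1t1, sub_eq_add_neg, hneg] at h1tt ht1t htt1 ⊢
  · rw [← hneg (c 1 1 _)]
    exact (eq_neg_of_add_eq_zero_left h1tt).symm
  · exact hM _
  · rw [add_assoc _ n n, hM, add_zero, ← sub_eq_zero, sub_eq_add_neg, hneg, ← ht1t]
    abel
  · rw [add_assoc _ n n, hM, add_zero, ← sub_eq_zero, sub_eq_add_neg, hneg, htt1]
  · rw [← sub_eq_zero, sub_eq_add_neg, hneg, ← hM (ρ _ n + n)]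
    nth_rewrite 2 [← hn]
    abel

/-- A group killed by 2 is a vector space over `ℤ/2`, where a functional separates a vector from a
subspace; its non-zero value can only be 1. -/
theorem exists_hom_eq_one {M : Type*} [AddCommGroup M] (hM : ∀ m : M, m + m = 0)
    (S : AddSubgroup M) {x : M} (hx : x ∉ S) :
    ∃ φ : M →+ ZMod 2, φ x = 1 ∧ ∀ y ∈ S, φ y = 0 := by
  let : Module (ZMod 2) M := AddCommGroup.zmodModule fun m => by rw [two_nsmul, hM]
  obtain ⟨φ, h1, h2⟩ := Submodule.exists_le_ker_of_notMem (p := AddSubgroup.toZModSubmodule 2 S) hx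
  have h3 : ∀ r : ZMod 2, r ≠ 0 → r = 1 := by decide
  exact ⟨φ.toAddMonoidHom, h3 _ h1, fun y hy => h2 hy⟩

/-- A 3-cocycle of `C₂` with values in a module killed by 2 which is not a coboundary can be
mapped to the cube of the generator of `H¹(C₂, ℤ/2ℤ)`. -/
theorem exists_hom_cohomologous_cube {M : Type*} [AddCommGroup M] [Module ℤ M] (hM : ∀ m : M, m + m = 0)
    (ρ : Representation ℤ C₂ M) (c : C₂ → C₂ → C₂ → M)
    (hc : ∀ g h k l, ρ g (c h k l) - c (g * h) k l + c g (h * k) l - c g h (k * l) +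
      c g h k = 0)
    (hne : ¬ ∃ e : C₂ → C₂ → M, ∀ g h k,
      ρ g (e h k) - e (g * h) k + e g (h * k) - e g h = c g h k) :
    ∃ φ : M →+ ZMod 2, (∀ g m, φ (ρ g m) = φ m) ∧ ∃ e : C₂ → C₂ → ZMod 2, ∀ g h k,
      e h k - e (g * h) k + e g (h * k) - e g h =
        φ (c g h k) - g.toAdd * h.toAdd * k.toAdd := by
  let t : C₂ := Multiplicative.ofAdd 1
  have ht : ∀ g : C₂, g = 1 ∨ g = t := by decide
  have ht1 : t ≠ 1 := by decide
  have htt : t * t = 1 := by decide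
  -- The image of the norm `1 + t`; the invariant of `c` must lie outside it, as otherwise `c` would
  -- be a coboundary.
  let S := ((ρ t).toAddMonoidHom + AddMonoidHom.id M).range
  have hS : c t t t + c 1 1 t + c t 1 1 ∉ S := by
    rintro ⟨n, hn⟩
    exact hne (exists_coboundary_of_eq_norm hM ρ c hc n t ht ht1 htt hn.symm)
  obtain ⟨φ, hφ1, hφ⟩ := exists_hom_eq_one hM S hS
  have hinv : ∀ g m, φ (ρ g m) = φ m := by
    intro g m
    rcases ht g with rfl | rfl
    · rw [map_one, Module.End.one_apply]
    -- Vanishing on `t m + m` is invariance under `t`, in characteristic 2.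
    · have := hφ _ ⟨m, rfl⟩
      rw [AddMonoidHom.add_apply, map_add] at this
      exact CharTwo.add_eq_zero.1 this
  have hl := fun g h k m => congrArg φ (hc g h k m)
  simp only [map_add, map_sub, hinv, map_zero] at hl hφ1
  -- The cube of the generator has invariant 1, like `φ ∘ c`, so their difference has invariant 0,
  -- which is the norm of `n = 0`.
  obtain ⟨e, he⟩ := exists_coboundary_of_eq_norm (M := ZMod 2) CharTwo.add_self_eq_zero
    (Representation.trivial ℤ C₂ (ZMod 2))
    (fun g h k => φ (c g h k) - g.toAdd * h.toAdd * k.toAdd)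
    (fun g h k m => by
      rw [Representation.isTrivial_def, LinearMap.id_apply, toAdd_mul, toAdd_mul, toAdd_mul]
      linear_combination hl g h k m) 0 t ht ht1 htt (by
      rw [map_zero, add_zero]
      refine Eq.trans ?_ (sub_eq_zero.2 hφ1)
      change φ _ - 1 * 1 * 1 + (φ _ - 0 * 0 * 1) + (φ _ - 1 * 0 * 0) = _
      ring)
  exact ⟨φ, hinv, e, he⟩

/-- Doubling is already zero on 2-cycles, whose coefficients lie in `ℤ/2`. -/
theorem H₂_add_self (P : Type) [Group P] (m : H₂ P (ZMod 2)) : m + m = 0 := by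
  induction m using groupHomology.H2_induction_on with | h x => ?_
  rw [← map_add]
  have : x + x = 0 := Subtype.ext (Finsupp.ext fun y => CharTwo.add_self_eq_zero _)
  rw [this, map_zero]

end Torsion

/-! ### Non-existence of solutions of embedding problems. -/

section Main

variable {G H : Type} [Group G] [TopologicalSpace G] [DiscreteTopology G] [Group H]
  [TopologicalSpace H] [DiscreteTopology H]
  {Γ : Type u} [Group Γ] [TopologicalSpace Γ] [IsTopologicalGroup Γ] [LocallyCompactSpace Γ]

/-- If the push-forward of the cocycle of the crossed module along an invariant homomorphism is
cohomologous to `a ∪ b ∪ c`, then the existence of a solution of the embedding problem makes the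
pullback of `a ∪ b ∪ c` vanish. -/
theorem contCupClass_pullback_eq_zero {f : G →* H} (hf : Function.Surjective f) {p : Γ →ₜ* H}
    (hp : HasSolution f p) {A : Type} [AddCommGroup A] {x : A}
    {D : ObstructionCrossedModule f A x} (l : D.Lift) (a b c : H →* C₂)
    (φ : H₂ f.ker A →+ ZMod 2) (hφ : ∀ h m, φ (outerH₂ hf A h m) = φ m)
    (e : H → H → ZMod 2) (he : ∀ g h k, e h k - e (g * h) k + e g (h * k) - e g h =
      φ (l.cochain ![g, h, k]) - (a g).toAdd * (b h).toAdd * (c k).toAdd) :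
    contCupClass (pullback p a) (pullback p b) (pullback p c) = 0 := by
  obtain ⟨q, hq⟩ := hp
  obtain ⟨E, hE⟩ := l.exists_coboundary hf
  -- On `G`, the cochain `φ ∘ E` bounds the inflated cocycle pushed forward by `φ`, and the
  -- inflation of `e` bounds its difference from the cup product. Subtracting gives a cochain that
  -- bounds the inflated cup product.
  refine cls_cup_homCocycle_eq_zero q _ _ _ (fun g => (a (f g)).toAdd) (fun g => (b (f g)).toAdd)
    (fun g => (c (f g)).toAdd) (fun γ => by rw [hq]; rfl) (fun γ => by rw [hq]; rfl)
    (fun γ => by rw [hq]; rfl) (fun g h => φ (E g h) - e (f g) (f h)) fun g h k => ?_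
  have h1 := congrArg φ (hE g h k)
  rw [map_sub, map_add, map_sub, hφ] at h1
  have h2 := he (f g) (f h) (f k)
  rw [map_mul, map_mul]
  linear_combination h1 - h2

omit [IsTopologicalGroup Γ] [LocallyCompactSpace Γ] in
theorem pullback_surjective {p : Γ →ₜ* H} (hp : Function.Surjective p) {a : H →* C₂}
    (ha : a ≠ 1) : Function.Surjective (pullback p a) := by
  obtain ⟨h, hh⟩ := DFunLike.ne_iff.1 ha
  obtain ⟨γ, rfl⟩ := hp h
  intro y
  have key : ∀ u y : C₂, u ≠ 1 → y = 1 ∨ y = u := by decide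
  rcases key (a (p γ)) y hh with rfl | rfl
  exacts [⟨1, map_one _⟩, ⟨γ, rfl⟩]

omit [IsTopologicalGroup Γ] [LocallyCompactSpace Γ] in
theorem pullback_ne_pullback {p : Γ →ₜ* H} (hp : Function.Surjective p) {a b : H →* C₂}
    (hab : a ≠ b) : pullback p a ≠ pullback p b := by
  obtain ⟨h, hh⟩ := DFunLike.ne_iff.1 hab
  obtain ⟨γ, rfl⟩ := hp h
  exact fun h => hh (DFunLike.congr_fun h γ)

omit [TopologicalSpace G] [DiscreteTopology G] [TopologicalSpace H] [DiscreteTopology H] in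
-- A non-zero obstruction excludes the default value 0, so a crossed module is available without any
-- existence theorem.
theorem exists_lift_of_obstruction_ne_zero {f : G →* H} (hf : Function.Surjective f)
    {A : Type} [AddCommGroup A] {x : A} (ho : obstruction hf A x ≠ 0) :
    ∃ (D : ObstructionCrossedModule f A x) (l : D.Lift), groupCohomology.π (H₂Rep hf A) 3
      (groupCohomology.cocyclesMk l.cochain (l.cocycle hf)) ≠ 0 := by
  unfold obstruction at ho
  split_ifs at ho with hD
  · exact ⟨hD.some, _, ho⟩
  · exact absurd rfl ho

/-- The embedding problem `(f, p)` over `ℤ/2ℤ` has no solution if the obstruction of `f` and the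
cube of the class of `p` are non-zero. -/
theorem not_hasSolution_of_obstruction_ne_zero {f : G →* C₂} (hf : Function.Surjective f)
    {p : Γ →ₜ* C₂} (hx : contCupClass p p p ≠ 0) (ho : obstruction hf (ZMod 2) 1 ≠ 0) :
    ¬ HasSolution f p := by
  intro hp
  obtain ⟨D, l, ho⟩ := exists_lift_of_obstruction_ne_zero hf ho
  have hl : ∀ g h k m, outerH₂ hf (ZMod 2) g (l.cochain ![h, k, m]) - l.cochain ![g * h, k, m] +
      l.cochain ![g, h * k, m] - l.cochain ![g, h, k * m] + l.cochain ![g, h, k] = 0 :=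
    fun g h k m => (d_three_apply (H₂Rep hf (ZMod 2)) l.cochain g h k m).symm.trans
      (congrFun (l.cocycle hf) _)
  obtain ⟨φ, hφ, e, he⟩ := exists_hom_cohomologous_cube (H₂_add_self _) (outerH₂ hf (ZMod 2))
    (fun g h k => l.cochain ![g, h, k]) hl (by
      rintro ⟨e, he⟩
      refine ho (π_cocyclesMk_eq_zero (A := H₂Rep hf (ZMod 2)) (n := 2) _ (l.cocycle hf)
        (fun x => e (x 0) (x 1)) (funext fun x => ?_))
      have hx : x = ![x 0, x 1, x 2] := by funext i; fin_cases i <;> rfl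
      rw [hx]
      exact (d_two_apply (H₂Rep hf (ZMod 2)) _ _ _ _).trans (he _ _ _))
  -- The pullback along `p` of the identity of `C₂` is `p` itself.
  exact hx (contCupClass_pullback_eq_zero hf hp l (.id C₂) (.id C₂) (.id C₂) φ hφ e he)

/-- The embedding problem `(f, p)` over `ℤ/2ℤ × ℤ/2ℤ` has no solution if the obstruction of `f` is
`a² ∪ b` and the pullback of `a² ∪ b` along `p` is non-zero. -/
theorem not_hasSolution_of_obstructionEqCup {f : G →* C₂ × C₂} (hf : Function.Surjective f)
    {p : Γ →ₜ* C₂ × C₂} {a b : C₂ × C₂ →* C₂} (h : ObstructionEqCup hf a b)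
    (hx : contCupClass (pullback p a) (pullback p a) (pullback p b) ≠ 0) :
    ¬ HasSolution f p := by
  intro hp
  refine hx ?_
  obtain ⟨φ, hφ⟩ := h
  have hcochain : ∀ g h k, cochainCup (cochainCup (homCochain a) (homCochain a)) (homCochain b)
      ![g, h, k] = (a g).toAdd * (a h).toAdd * (b k).toAdd := fun g h k => rfl
  unfold obstruction at hφ
  split_ifs at hφ with hD
  · let l := (hD.some.nonempty_lift hf).some
    obtain ⟨e, he⟩ := exists_d_eq_of_map_π_eq φ.hom (n := 2) l.cochain (l.cocycle hf) _ _ hφ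
    refine contCupClass_pullback_eq_zero hf hp l a a b φ.hom.hom.toLinearMap.toAddMonoidHom
      (fun h m => ?_) (fun g h => e ![g, h]) fun g h k => ?_
    -- Equivariance towards a trivial module is invariance of the functional.
    · exact Rep.hom_comm_apply φ.hom h m
    · exact (d_two_apply (Rep.trivial ℤ (C₂ × C₂) (ZMod 2)) e g h k).symm.trans
        (congrFun he ![g, h, k])
  -- If no crossed module exists, the obstruction has its default value 0, and the hypothesis says
  -- that `a² ∪ b` is already a coboundary on `C₂ × C₂`. Its pullback along `p` then vanishes
  -- without using a solution.
  · obtain ⟨e, he⟩ := exists_d_eq_of_π_eq_zero (n := 2) _ (d_cup_homCochain a a b)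
      (hφ.symm.trans (map_zero _))
    exact cls_cup_homCocycle_eq_zero p _ _ _ (fun g => (a g).toAdd) (fun g => (a g).toAdd)
      (fun g => (b g).toAdd) (fun γ => rfl) (fun γ => rfl)
      (fun γ => rfl) (fun g h => e ![g, h]) fun g h k =>
        (d_two_apply (Rep.trivial ℤ (C₂ × C₂) (ZMod 2)) e g h k).symm.trans
          (congrFun he ![g, h, k])

end Main

end EmbeddingObstruction

end

theorem mainTheorem11 {G : Type} [Group G] [Finite G] [TopologicalSpace G] [DiscreteTopology G]
    {Γ : Type u} [Group Γ] [TopologicalSpace Γ] [IsTopologicalGroup Γ] [CompactSpace Γ]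
    [TotallyDisconnectedSpace Γ] :
    -- Embedding problems over `ℤ/2ℤ`.
    (∀ (f : G →* EmbeddingObstruction.C₂) (p : Γ →ₜ* EmbeddingObstruction.C₂)
        (hf : Function.Surjective f), Function.Surjective p →
        EmbeddingObstruction.IsPerfectFor (ZMod 2) f.ker →
        EmbeddingObstruction.contCupClass p p p ≠ 0 →
        EmbeddingObstruction.obstruction hf (ZMod 2) 1 ≠ 0 →
        ¬ EmbeddingObstruction.HasSolution f p) ∧
    -- Embedding problems over `ℤ/2ℤ × ℤ/2ℤ`.
    (∀ (f : G →* EmbeddingObstruction.C₂ × EmbeddingObstruction.C₂)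
        (p : Γ →ₜ* EmbeddingObstruction.C₂ × EmbeddingObstruction.C₂)
        (hf : Function.Surjective f), Function.Surjective p →
        EmbeddingObstruction.IsPerfectFor (ZMod 2) f.ker →
        Nonempty (EmbeddingObstruction.H₂ f.ker (ZMod 2) ≃+ ZMod 2) →
        ∀ a b : EmbeddingObstruction.C₂ × EmbeddingObstruction.C₂ →* EmbeddingObstruction.C₂,
          a ≠ 1 → b ≠ 1 → a ≠ b →
          EmbeddingObstruction.ObstructionEqCup hf a b →
          EmbeddingObstruction.contCupClass (EmbeddingObstruction.pullback p a)
            (EmbeddingObstruction.pullback p a) (EmbeddingObstruction.pullback p b) ≠ 0 →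
          ¬ EmbeddingObstruction.HasSolution f p) ∧
    -- No surjections, for the properties with index `a` and with index `b`.
    (EmbeddingObstruction.PropertyStarA G → EmbeddingObstruction.PropertyStarStarA Γ →
      ¬ ∃ q : Γ →ₜ* G, Function.Surjective q) ∧
    (EmbeddingObstruction.PropertyStarB G → EmbeddingObstruction.PropertyStarStarB Γ →
      ¬ ∃ q : Γ →ₜ* G, Function.Surjective q) := by
  refine ⟨fun f p hf _ _ hx ho =>
      EmbeddingObstruction.not_hasSolution_of_obstruction_ne_zero hf hx ho,
    fun f p hf _ _ _ a b _ _ _ h hx =>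
      EmbeddingObstruction.not_hasSolution_of_obstructionEqCup hf h hx, ?_, ?_⟩
  · rintro ⟨f, hf, -, ho⟩ hΓ ⟨q, hq⟩
    -- With `p = f ∘ q`, the map `q` is tautologically a solution of the embedding problem.
    let p : Γ →ₜ* EmbeddingObstruction.C₂ := EmbeddingObstruction.pullback q f
    exact EmbeddingObstruction.not_hasSolution_of_obstruction_ne_zero hf
      (hΓ p (hf.comp hq)) ho ⟨q, fun _ => rfl⟩
  · rintro ⟨f, hf, -, -, a, b, ha, hb, hab, ho⟩ hΓ ⟨q, hq⟩
    let p : Γ →ₜ* EmbeddingObstruction.C₂ × EmbeddingObstruction.C₂ :=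
      ⟨f.comp q.toMonoidHom, (continuous_of_discreteTopology (f := f)).comp q.continuous_toFun⟩
    have hp : Function.Surjective p := hf.comp hq
    -- Surjectivity of `p` makes the pullbacks of `a` and `b` distinct and surjective, as the
    -- property of `Γ` requires.
    exact EmbeddingObstruction.not_hasSolution_of_obstructionEqCup hf ho
      (hΓ _ _ (EmbeddingObstruction.pullback_surjective hp ha)
        (EmbeddingObstruction.pullback_surjective hp hb)
        (EmbeddingObstruction.pullback_ne_pullback hp hab)) ⟨q, fun _ => rfl⟩
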